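/- For a positive integer $N$ and a probability distribution $D$ on $[N]=\{1,\dots,N\}$, let $\mathsf{ICOND}_D$ be the oracle which, queried on an interval $I=\{a,a+1,\dots,b\}\subseteq[N]$ (with $a\le b$), returns an element $s\in I$ with probability $D(s)/D(I)$, independently of all previous calls; if $D(I)=0$, the oracle and the algorithm fail and terminate. Let $\mathcal U$ be the uniform distribution on $[N]$ and let $d_{\mathrm{TV}}(D,D')=\frac12\sum_{i\in[N]}|D(i)-D'(i)|$. A $q$-query $\mathsf{ICOND}$ algorithm for testing uniformity over $[N]$ with distance parameter $\epsilon$ is a randomized, possibly adaptive algorithm which makes at most $q$ oracle calls and which outputs ACCEPT with probability at least $2/3$ if $D=\mathcal U$, and outputs REJECT with probability at least $2/3$ if $d_{\mathrm{TV}}(D,\mathcal U)\ge\epsilon$. **Theorem 8.3.** Fix $\epsilon=1/3$. Any $\mathsf{ICOND}$ algorithm for testing whether $D=\mathcal U$ versus $d_{\mathrm{TV}}(D,\mathcal U)\ge\epsilon$ must make $\Omega\!\left(\frac{\log N}{\log\log N}\right)$ queries. That is, there are absolute constants $c>0$ and $N_0$ such that for every $N\ge N_0$ and every $q$, if there is a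 $q$-query $\mathsf{ICOND}$ algorithm for testing uniformity over $[N]$ with distance parameter $1/3$, then $$q\;\ge\; c\cdot\frac{\log N}{\log\log N}.$$ -/

import Mathlib

noncomputable section

namespace DistributionTesting

/-- Total variation distance `(1/2) ∑ |D₁(i) - D₂(i)|` between two distributions on `[N]`.
The `N`-element ordered domain `[N]` is represented by `Fin N`. -/
def tvDist {N : ℕ} (D₁ D₂ : PMF (Fin N)) : ℝ :=
  (1 / 2) * ∑ i, |(D₁ i).toReal - (D₂ i).toReal|

/-- The interval-conditional sampling oracle for `D`, queried on the interval `[a, b]`.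
If `D([a, b]) > 0` it returns `some s` with probability `D(s) / D([a, b])` for each `s ∈ [a, b]`;
if `D([a, b]) = 0` it returns `none` (failure). -/
def icond {N : ℕ} (D : PMF (Fin N)) (a b : Fin N) : PMF (Option (Set.Icc a b)) :=
  if h : (∑' s : Set.Icc a b, D s) = 0 then
    PMF.pure none
  else
    (PMF.normalize (fun s : Set.Icc a b => D s) h
      (ne_top_of_le_ne_top ENNReal.one_ne_top
        ((ENNReal.tsum_comp_le_tsum_of_injective Subtype.val_injective D).trans
          D.tsum_coe.le))).map some

/-- Possible outcomes of an execution. -/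
inductive Outcome where
  | accept
  | reject
  | fail

/-- A deterministic adaptive algorithm with access to an interval-conditional sampling oracle for
a distribution on `[N]`: it either halts with an outcome, or queries a nonempty interval `[a, b]`
and continues in a way that depends on the point `s ∈ [a, b]` that is returned (hence on the
whole history of the interaction). -/
inductive DetAlg (N : ℕ) where
  | halt (o : Outcome) : DetAlg N
  | query (a b : Fin N) (hab : a ≤ b) (next : Set.Icc a b → DetAlg N) : DetAlg N

/-- The largest number of oracle queries made in any execution. -/
def DetAlg.queries {N : ℕ} : DetAlg N → ℕ
  | .halt _ => 0
  | .query _ _ _ next => 1 + Finset.univ.sup fun s => (next s).queries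

/-- The law of the outcome when a deterministic algorithm interacts with the oracle for `D`;
each query is answered independently of all previous ones, and the execution terminates with
outcome `fail` when the oracle fails. -/
def DetAlg.run {N : ℕ} (D : PMF (Fin N)) : DetAlg N → PMF Outcome
  | .halt o => PMF.pure o
  | .query a b _ next => (icond D a b).bind fun
      | none => PMF.pure .fail
      | some s => (next s).run D

/-- A randomized adaptive algorithm: its internal randomness selects a deterministic one.
(For fixed `N` there are only countably many deterministic algorithms, so that a `PMF` is
the most general probability distribution over them.) -/
abbrev RandAlg (N : ℕ) := PMF (DetAlg N)

/-- The law of the outcome when a randomized algorithm interacts with the oracle for `D`, over its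
internal randomness and the randomness of the oracle. -/
def RandAlg.run {N : ℕ} (T : RandAlg N) (D : PMF (Fin N)) : PMF Outcome :=
  PMF.bind T fun t => t.run D

/-- `T` makes at most `q` oracle queries, with probability one. -/
def RandAlg.MakesAtMost {N : ℕ} (T : RandAlg N) (q : ℕ) : Prop :=
  ∀ t ∈ PMF.support T, t.queries ≤ q

/-- `T` is a `q`-query algorithm, using the interval-conditional sampling oracle, that tests
whether the unknown distribution on `[N]` is uniform or `ε`-far from uniform. -/
structure IsUniformityTester {N : ℕ} [NeZero N] (T : RandAlg N) (ε : ℝ) (q : ℕ) : Prop where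
  queries_le : T.MakesAtMost q
  accepts : ∀ D : PMF (Fin N), D = PMF.uniformOfFintype (Fin N) →
    2 / 3 ≤ (T.run D .accept).toReal
  rejects : ∀ D : PMF (Fin N), ε ≤ tvDist D (PMF.uniformOfFintype (Fin N)) →
    2 / 3 ≤ (T.run D .reject).toReal

end DistributionTesting

end

/-! The far distributions are random perturbations of the uniform one. Choose a scale `k < m`
uniformly, put `L = K ^ (2 * k)`, cut the domain into blocks of length `L` after a uniform shift `t
< L`, group the blocks in adjacent pairs, and with an independent sign per pair make the density `1
± 3/4` on one block and `1 ∓ 3/4` on the other. Against such a density, a query inside one block is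
answered exactly uniformly. A query of length at least `K * L` has nearly the right total mass,
because whole pairs cancel, and its answer looks uniform on average over the signs until some pair
is hit twice. A fixed query escapes both cases only if its length is within a factor `K` of `L`,
which happens for at most one scale, or if a block boundary cuts a short query, which has
probability at most `1 / K` over the shift. `DetAlg.goodAcc` counts the accepting uniform runs that
avoid these accidents. `DetAlg.sum_acc_sub_goodAcc_le` bounds what it loses,
`DetAlg.goodAcc_mul_sum_le` transfers it to the perturbations, and `IsUniformityTester.one_third_le`
is the averaging principle that turns closeness into impossibility. With `m` of order `q` and `K` of
order `q ^ 2` the total error is below `1/3`, so the largest block `K ^ (12 * q)` cannot fit into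
`N`; taking logarithms gives the bound. -/

noncomputable section

namespace DistributionTesting

open Finset

/-! ### Acceptance probabilities as real numbers, and good runs -/

/-- The indicator of the outcome `accept`. -/
def Outcome.acceptVal : Outcome → ℝ
  | .accept => 1
  | .reject => 0
  | .fail => 0

lemma Outcome.acceptVal_nonneg (o : Outcome) : 0 ≤ o.acceptVal := by
  cases o <;> simp [acceptVal]

lemma Outcome.acceptVal_le_one (o : Outcome) : o.acceptVal ≤ 1 := by
  cases o <;> simp [acceptVal]

/-- The acceptance probability when the oracle answers with probabilities proportional to the
(not necessarily normalized) density `f`. -/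
def DetAlg.acc {N : ℕ} (f : Fin N → ℝ) : DetAlg N → ℝ
  | .halt o => o.acceptVal
  | .query a b _ next => ∑ s : Set.Icc a b, f s / (∑ r : Set.Icc a b, f r) * (next s).acc f

/-- The probability, for the uniform distribution, of accepting after a run in which every query
is either `long`, with an answer whose class under `p` has not been seen in `H` or in the answer to
an earlier long query, or else `flat`. -/
def DetAlg.goodAcc {N : ℕ} {J : Type} [DecidableEq J] (p : Fin N → J)
    (long flat : Fin N → Fin N → Prop) [DecidableRel long] [DecidableRel flat] :
    DetAlg N → Finset J → ℝ
  | .halt o, _ => o.acceptVal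
  | .query a b _ next, H =>
    if long a b then
      (∑ s : Set.Icc a b, if p s ∈ H then 0 else (next s).goodAcc p long flat (insert (p s) H)) /
        Fintype.card (Set.Icc a b)
    -- A flat answer has the same law for all signs, so it reveals none and `H` does not grow.
    else if flat a b then
      (∑ s : Set.Icc a b, (next s).goodAcc p long flat H) / Fintype.card (Set.Icc a b)
    else 0

lemma card_Icc_pos {N : ℕ} {a b : Fin N} (hab : a ≤ b) :
    (0 : ℝ) < Fintype.card (Set.Icc a b) := by
  have : Nonempty (Set.Icc a b) := ⟨⟨a, Set.left_mem_Icc.2 hab⟩⟩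
  exact_mod_cast Fintype.card_pos

lemma DetAlg.acc_nonneg {N : ℕ} {f : Fin N → ℝ} (hf : ∀ i, 0 ≤ f i) (t : DetAlg N) :
    0 ≤ t.acc f := by
  induction t with
  | halt o => exact o.acceptVal_nonneg
  | query a b hab next ih =>
    exact sum_nonneg fun s _ =>
      mul_nonneg (div_nonneg (hf _) (sum_nonneg fun r _ => hf _)) (ih s)

lemma DetAlg.acc_one_query {N : ℕ} (a b : Fin N) (hab : a ≤ b) (next : Set.Icc a b → DetAlg N) :
    (DetAlg.query a b hab next).acc (fun _ => 1) =
      (∑ s, (next s).acc fun _ => 1) / Fintype.card (Set.Icc a b) := by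
  simp only [acc, sum_const, card_univ, nsmul_eq_mul, mul_one, sum_div]
  exact sum_congr rfl fun s _ => by ring

lemma DetAlg.acc_one_le_one {N : ℕ} (t : DetAlg N) : t.acc (fun _ => 1) ≤ 1 := by
  induction t with
  | halt o => exact o.acceptVal_le_one
  | query a b hab next ih =>
    rw [acc_one_query, div_le_one (card_Icc_pos hab)]
    calc ∑ s, (next s).acc (fun _ => 1) ≤ ∑ s : Set.Icc a b, (1 : ℝ) := sum_le_sum fun s _ => ih s
      _ = _ := by simp

section goodAcc

variable {N : ℕ} {J : Type} [DecidableEq J] (p : Fin N → J) (long flat : Fin N → Fin N → Prop)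
  [DecidableRel long] [DecidableRel flat]

lemma DetAlg.goodAcc_nonneg (t : DetAlg N) (H : Finset J) : 0 ≤ t.goodAcc p long flat H := by
  induction t generalizing H with
  | halt o => exact o.acceptVal_nonneg
  | query a b hab next ih =>
    unfold goodAcc
    split_ifs
    · refine div_nonneg (sum_nonneg fun s _ => ?_) (card_Icc_pos hab).le
      split_ifs
      · exact le_rfl
      · exact ih s _
    · exact div_nonneg (sum_nonneg fun s _ => ih s _) (card_Icc_pos hab).le
    · exact le_rfl

lemma DetAlg.goodAcc_le_acc (t : DetAlg N) (H : Finset J) :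
    t.goodAcc p long flat H ≤ t.acc (fun _ => 1) := by
  induction t generalizing H with
  | halt o => exact le_rfl
  | query a b hab next ih =>
    have hpos := card_Icc_pos hab
    rw [acc_one_query]
    unfold goodAcc
    split_ifs
    · gcongr with s
      split_ifs
      · exact acc_nonneg (fun _ => zero_le_one) _
      · exact ih s _
    · gcongr with s
      exact ih s _
    · exact div_nonneg (sum_nonneg fun s _ => acc_nonneg (fun _ => zero_le_one) _) hpos.le

end goodAcc

lemma DetAlg.exists_queries_succ {N n : ℕ} {a b : Fin N} {hab : a ≤ b}
    {next : Set.Icc a b → DetAlg N} (h : (DetAlg.query a b hab next).queries ≤ n) :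
    ∃ k, n = k + 1 ∧ ∀ s, (next s).queries ≤ k := by
  simp only [queries] at h
  refine ⟨n - 1, by omega, fun s => ?_⟩
  have := Finset.le_sup (f := fun s => (next s).queries) (mem_univ s)
  omega

/-! ### Good runs under random signs -/

/-- Flip the `j`-th coordinate of `x`. -/
def flip {J : Type} [DecidableEq J] (j : J) (x : J → Bool) : J → Bool :=
  Function.update x j (!x j)

lemma flip_involutive {J : Type} [DecidableEq J] (j : J) : Function.Involutive (flip j) := by
  intro x
  simp [flip]

lemma sum_comp_flip {J : Type} [DecidableEq J] [Fintype J] (j : J) (F : (J → Bool) → ℝ) :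
    ∑ x, F (flip j x) = ∑ x, F x :=
  Equiv.sum_comp (flip_involutive j).toPerm F

/-- A random perturbation of the uniform density whose fluctuation on the class `j` of the
partition `p` has a sign given by an independent random bit answers queries like the uniform
distribution does, on average and as long as no class is sampled twice by long queries. -/
lemma DetAlg.goodAcc_mul_sum_le {N : ℕ} {J : Type} [DecidableEq J] [Fintype J]
    (p : Fin N → J) (long flat : Fin N → Fin N → Prop) [DecidableRel long] [DecidableRel flat]
    (f : (J → Bool) → Fin N → ℝ)
    (hf : ∀ x i, 0 < f x i)
    (hflip : ∀ j x i, f (flip j x) i = if p i = j then 2 - f x i else f x i)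
    {ρ : ℝ} (hρ : 0 ≤ ρ) (hρ1 : ρ ≤ 1)
    (hlong : ∀ a b, long a b → ∀ x,
      ρ * ∑ s : Set.Icc a b, f x s ≤ Fintype.card (Set.Icc a b))
    (hflat : ∀ a b, flat a b → ∀ x, ∀ s : Set.Icc a b, f x s = f x a)
    (t : DetAlg N) (n : ℕ) (hn : t.queries ≤ n) (H : Finset J) (φ : (J → Bool) → ℝ)
    (hφ : ∀ x, 0 ≤ φ x) (hφH : ∀ j ∉ H, ∀ x, φ (flip j x) = φ x) :
    ρ ^ n * t.goodAcc p long flat H * ∑ x, φ x ≤ ∑ x, φ x * t.acc (f x) := by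
  induction t generalizing n H φ with
  | halt o =>
    simp only [goodAcc, acc]
    rw [← sum_mul, mul_comm]
    have := pow_le_one₀ hρ hρ1 (n := n)
    exact mul_le_mul_of_nonneg_left (mul_le_of_le_one_left o.acceptVal_nonneg this)
      (sum_nonneg fun x _ => hφ x)
  | query a b hab next ih =>
    obtain ⟨k, rfl, hk⟩ := exists_queries_succ hn
    have hc := card_Icc_pos hab
    have hacc : ∀ x s, 0 ≤ (next s).acc (f x) := fun x s => acc_nonneg (fun i => (hf x i).le) _
    have hne : (univ : Finset (Set.Icc a b)).Nonempty := ⟨⟨a, Set.left_mem_Icc.2 hab⟩, mem_univ _⟩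
    have hF : ∀ x, 0 < ∑ s : Set.Icc a b, f x s := fun x => sum_pos (fun s _ => hf x s) hne
    simp only [acc]
    unfold goodAcc
    split_ifs with h1 h2
    · calc _ = ∑ s : Set.Icc a b, ρ / Fintype.card (Set.Icc a b) * (ρ ^ k *
              (if p s ∈ H then 0 else (next s).goodAcc p long flat (insert (p s) H)) *
                ∑ x, φ x) := by
            rw [pow_succ, sum_div, mul_assoc, mul_assoc, sum_mul, mul_sum, mul_sum]
            exact sum_congr rfl fun s _ => by ring
        _ ≤ ∑ s : Set.Icc a b, ρ / Fintype.card (Set.Icc a b) *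
              ∑ x, (φ x * f x s) * (next s).acc (f x) := by
            gcongr with s
            split_ifs with hs
            · simp only [mul_zero, zero_mul]
              exact sum_nonneg fun x _ => mul_nonneg (mul_nonneg (hφ x) (hf x s).le) (hacc x s)
            -- Flipping the unseen bit `p s` fixes `φ` and turns `f x s` into `2 - f x s`, so the
            -- average of `φ * f` equals twice that of `φ` minus itself.
            · have hsum : ∑ x, φ x = ∑ x, φ x * f x s := by
                have h := sum_comp_flip (p s) fun x => φ x * f x s
                simp only [hflip, hφH _ hs, if_true, mul_sub, sum_sub_distrib, ← sum_mul] at h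
                linarith
              rw [hsum]
              -- The likelihood of the answer is absorbed into the weight, which may now depend on
              -- the bit `p s` as well.
              refine ih s k (hk s) (insert (p s) H) (fun x => φ x * f x s)
                (fun x => mul_nonneg (hφ x) (hf x s).le) fun j hj x => ?_
              rw [mem_insert, not_or] at hj
              simp only [hflip, hφH _ hj.2, if_neg (Ne.symm hj.1)]
        _ = ∑ x, φ x * ∑ s : Set.Icc a b,
              f x s * (ρ / Fintype.card (Set.Icc a b)) * (next s).acc (f x) := by
            simp only [mul_sum]
            rw [sum_comm]
            exact sum_congr rfl fun x _ => sum_congr rfl fun s _ => by ring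
        _ ≤ _ := by
            gcongr with x _ s _
            · exact hφ x
            · exact hacc x s
            · rw [div_eq_mul_inv (f x s)]
              refine mul_le_mul_of_nonneg_left ?_ (hf x s).le
              rw [div_le_iff₀ hc, inv_mul_eq_div, le_div_iff₀ (hF x)]
              exact hlong a b h1 x
    · calc _ = ∑ s : Set.Icc a b, ρ / Fintype.card (Set.Icc a b) * (ρ ^ k *
              (next s).goodAcc p long flat H * ∑ x, φ x) := by
            rw [pow_succ, sum_div, mul_assoc, mul_assoc, sum_mul, mul_sum, mul_sum]
            exact sum_congr rfl fun s _ => by ring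
        -- A flat query costs nothing, so its factor `ρ ≤ 1` is simply given up.
        _ ≤ ∑ s : Set.Icc a b, 1 / Fintype.card (Set.Icc a b) *
              ∑ x, φ x * (next s).acc (f x) := by
            gcongr with s
            · exact mul_nonneg (mul_nonneg (pow_nonneg hρ _) (goodAcc_nonneg ..))
                (sum_nonneg fun x _ => hφ x)
            · exact ih s k (hk s) H φ hφ hφH
        _ = _ := by
            simp only [mul_sum]
            rw [sum_comm]
            refine sum_congr rfl fun x _ => sum_congr rfl fun s _ => ?_
            have hx : ∑ r : Set.Icc a b, f x r = Fintype.card (Set.Icc a b) * f x a := by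
              rw [sum_congr rfl fun r _ => hflat a b h2 x r]
              simp
            have := (hf x a).ne'
            have := hc.ne'
            rw [hx, hflat a b h2 x s]
            field_simp
    · simp only [mul_zero, zero_mul]
      exact sum_nonneg fun x _ => mul_nonneg (hφ x) (sum_nonneg fun s _ =>
        mul_nonneg (div_nonneg (hf x s).le (hF x).le) (hacc x s))

/-! ### Probability of leaving the good runs -/

/-- The total loss from restricting to good runs, averaged over a family of partitions. -/
lemma DetAlg.sum_acc_sub_goodAcc_le {N : ℕ} {Θ : Type} (S : Finset Θ) (μ : Θ → ℝ)
    (hμ : ∀ θ, 0 ≤ μ θ) (hμ1 : ∑ θ ∈ S, μ θ = 1) {J : Θ → Type} [∀ θ, DecidableEq (J θ)]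
    (p : ∀ θ, Fin N → J θ) (long flat : Θ → Fin N → Fin N → Prop)
    [∀ θ, DecidableRel (long θ)] [∀ θ, DecidableRel (flat θ)] {β γ : ℝ} (hγ : 0 ≤ γ)
    (hlong : ∀ θ ∈ S, ∀ a b, long θ a b → ∀ j,
      (#{s : Set.Icc a b | p θ s = j} : ℝ) ≤ γ * Fintype.card (Set.Icc a b))
    (hbad : ∀ a b, a ≤ b →
      ∑ θ ∈ S, μ θ * (if long θ a b ∨ flat θ a b then 0 else 1) ≤ β)
    (t : DetAlg N) (n : ℕ) (hn : t.queries ≤ n) (h : ℕ) (H : ∀ θ, Finset (J θ))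
    (hH : ∀ θ, #(H θ) ≤ h) (hβ : 0 ≤ β) :
    ∑ θ ∈ S, μ θ * (t.acc (fun _ => 1) - t.goodAcc (p θ) (long θ) (flat θ) (H θ)) ≤
      n * (β + (h + n) * γ) := by
  induction t generalizing n h H with
  | halt o =>
    simp only [acc, goodAcc, sub_self, mul_zero, sum_const_zero]
    positivity
  | query a b hab next ih =>
    obtain ⟨k, rfl, hk⟩ := exists_queries_succ hn
    have hc := card_Icc_pos hab
    set c : ℝ := (Fintype.card (Set.Icc a b) : ℝ)
    let H' : Set.Icc a b → ∀ θ, Finset (J θ) := fun s θ =>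
      if long θ a b then insert (p θ s) (H θ) else H θ
    have hH' : ∀ s θ, #(H' s θ) ≤ h + 1 := fun s θ => by
      simp only [H']
      split_ifs
      · exact (card_insert_le _ _).trans (Nat.add_le_add_right (hH θ) 1)
      · exact (hH θ).trans (Nat.le_succ h)
    let d : Θ → Set.Icc a b → ℝ := fun θ s =>
      (next s).acc (fun _ => 1) - (next s).goodAcc (p θ) (long θ) (flat θ) (H' s θ)
    have hd : ∀ θ s, 0 ≤ d θ s := fun θ s => sub_nonneg.2 (goodAcc_le_acc ..)
    have key : ∀ θ ∈ S, (DetAlg.query a b hab next).acc (fun _ => 1) -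
        (DetAlg.query a b hab next).goodAcc (p θ) (long θ) (flat θ) (H θ) ≤
        (if long θ a b ∨ flat θ a b then 0 else 1) + h * γ + (∑ s, d θ s) / c := by
      intro θ hθ
      have hhγ : 0 ≤ h * γ := by positivity
      by_cases h1 : long θ a b
      -- Union bound over the at most `h` classes already seen.
      · have hcard : (#{s : Set.Icc a b | p θ s ∈ H θ} : ℝ) ≤ h * γ * c := by
          calc (#{s : Set.Icc a b | p θ s ∈ H θ} : ℝ)
              ≤ ∑ j ∈ H θ, (#{s : Set.Icc a b | p θ s = j} : ℝ) := by
                have : ({s : Set.Icc a b | p θ s ∈ H θ} : Finset _) ⊆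
                    (H θ).biUnion fun j => {s : Set.Icc a b | p θ s = j} := by
                  intro s
                  simp
                exact_mod_cast (card_le_card this).trans card_biUnion_le
            _ ≤ ∑ j ∈ H θ, γ * c := sum_le_sum fun j _ => hlong θ hθ a b h1 j
            _ = #(H θ) * (γ * c) := by simp
            _ ≤ h * (γ * c) := by
                have : (#(H θ) : ℝ) ≤ h := by exact_mod_cast hH θ
                gcongr
            _ = _ := by ring
        rw [acc_one_query]
        unfold goodAcc
        simp only [h1, true_or, if_true, zero_add]
        rw [← sub_div, div_le_iff₀ hc, add_mul, div_mul_cancel₀ _ hc.ne', ← sum_sub_distrib]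
        refine le_trans ?_ (add_le_add_left hcard _)
        rw [card_filter, Nat.cast_sum, ← sum_add_distrib]
        refine sum_le_sum fun s _ => ?_
        have e := hd θ s
        simp only [d, H', h1, if_true] at e ⊢
        split_ifs with h3
        · push_cast
          linarith [(next s).acc_one_le_one]
        · push_cast
          linarith
      · have hHs : ∀ s, H' s θ = H θ := fun s => by simp [H', h1]
        by_cases h2 : flat θ a b
        · rw [acc_one_query]
          unfold goodAcc
          simp only [h1, h2, or_true, if_true, if_false, zero_add, d, hHs, sum_sub_distrib, sub_div]
          linarith
        · have e1 := (DetAlg.query a b hab next).acc_one_le_one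
          have e2 := (DetAlg.query a b hab next).goodAcc_nonneg (p θ) (long θ) (flat θ) (H θ)
          have e3 : 0 ≤ (∑ s, d θ s) / c := div_nonneg (sum_nonneg fun s _ => hd θ s) hc.le
          simp only [h1, h2, or_false, if_false]
          linarith
    calc _ ≤ ∑ θ ∈ S, μ θ * ((if long θ a b ∨ flat θ a b then 0 else 1) + h * γ +
            (∑ s, d θ s) / c) :=
          sum_le_sum fun θ hθ => mul_le_mul_of_nonneg_left (key θ hθ) (hμ θ)
      _ = ∑ θ ∈ S, μ θ * (if long θ a b ∨ flat θ a b then 0 else 1) + h * γ +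
            (∑ s, ∑ θ ∈ S, μ θ * d θ s) / c := by
          simp only [mul_add, sum_add_distrib, ← sum_mul, hμ1, one_mul]
          congr 1
          -- Uniform answers have a law independent of `θ`, so the sums can be exchanged: after each
          -- answer `θ` still has its original weights, and both `hbad` and the induction hypothesis
          -- apply.
          rw [sum_comm, sum_div]
          refine sum_congr rfl fun θ _ => ?_
          rw [← mul_sum, mul_div_assoc]
      _ ≤ β + h * γ + (∑ s : Set.Icc a b, k * (β + ((h + 1 : ℕ) + k) * γ)) / c := by
          gcongr with s
          · exact hbad a b hab
          · exact ih s k (hk s) (h + 1) (H' s) (hH' s)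
      _ = β + h * γ + k * (β + ((h + 1 : ℕ) + k) * γ) := by
          simp only [sum_const, card_univ, nsmul_eq_mul]
          rw [mul_div_assoc, mul_div_cancel₀ _ hc.ne']
      _ ≤ _ := by
          push_cast
          have : 0 ≤ (k : ℝ) * γ := by positivity
          nlinarith

/-! ### From the oracle model to real acceptance probabilities -/

/-- Positivity of `f` rules out oracle failure, and the normalizing constant `c` cancels in the
conditional probability. -/
lemma icond_apply_some {N : ℕ} {D : PMF (Fin N)} {f : Fin N → ℝ} {c : ℝ} (hc : 0 < c)
    (hf : ∀ i, 0 < f i) (hD : ∀ i, D i = ENNReal.ofReal (c * f i)) {a b : Fin N} (hab : a ≤ b)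
    (s : Set.Icc a b) :
    icond D a b (some s) = ENNReal.ofReal (f s / ∑ r : Set.Icc a b, f r) := by
  have hne : (univ : Finset (Set.Icc a b)).Nonempty := ⟨⟨a, Set.left_mem_Icc.2 hab⟩, mem_univ _⟩
  have hF : 0 < ∑ r : Set.Icc a b, f r := sum_pos (fun r _ => hf r) hne
  have hsum : ∑' r : Set.Icc a b, D r = ENNReal.ofReal (c * ∑ r : Set.Icc a b, f r) := by
    rw [tsum_fintype, mul_sum, ENNReal.ofReal_sum_of_nonneg fun (r : Set.Icc a b) _ =>
      (mul_pos hc (hf r)).le]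
    exact sum_congr rfl fun r _ => hD r
  have h0 : ∑' r : Set.Icc a b, D r ≠ 0 := by
    rw [hsum]
    simpa using mul_pos hc hF
  rw [icond, dif_neg h0, PMF.map_apply, tsum_eq_single s]
  · rw [if_pos rfl, PMF.normalize_apply, hsum, hD, ← ENNReal.ofReal_inv_of_pos (mul_pos hc hF),
      ← ENNReal.ofReal_mul (mul_pos hc (hf s)).le]
    congr 1
    field_simp
  · intro r hr
    rw [if_neg]
    simpa using hr.symm

lemma DetAlg.run_accept {N : ℕ} {D : PMF (Fin N)} {f : Fin N → ℝ} {c : ℝ} (hc : 0 < c)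
    (hf : ∀ i, 0 < f i) (hD : ∀ i, D i = ENNReal.ofReal (c * f i)) (t : DetAlg N) :
    t.run D .accept = ENNReal.ofReal (t.acc f) := by
  induction t with
  | halt o => cases o <;> simp [run, acc, Outcome.acceptVal, PMF.pure_apply]
  | query a b hab next ih =>
    have h0 : ∀ s : Set.Icc a b, 0 ≤ f s / ∑ r : Set.Icc a b, f r := fun s =>
      div_nonneg (hf s).le (sum_nonneg fun r _ => (hf r).le)
    rw [run, PMF.bind_apply, tsum_fintype, Fintype.sum_option, acc,
      ENNReal.ofReal_sum_of_nonneg fun s _ => mul_nonneg (h0 s) (acc_nonneg (fun i => (hf i).le) _)]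
    simp only [PMF.pure_apply, reduceCtorEq, if_false, mul_zero, zero_add]
    refine sum_congr rfl fun s _ => ?_
    rw [icond_apply_some hc hf hD hab, ih s, ENNReal.ofReal_mul (h0 s)]

lemma RandAlg.run_accept {N : ℕ} {D : PMF (Fin N)} {f : Fin N → ℝ} {c : ℝ} (hc : 0 < c)
    (hf : ∀ i, 0 < f i) (hD : ∀ i, D i = ENNReal.ofReal (c * f i)) (T : RandAlg N) :
    T.run D .accept = ∑' t, T t * ENNReal.ofReal (t.acc f) := by
  rw [run, PMF.bind_apply]
  exact tsum_congr fun t => by rw [t.run_accept hc hf hD]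

lemma accept_add_reject_le_one (P : PMF Outcome) :
    (P .accept).toReal + (P .reject).toReal ≤ 1 := by
  classical
  rw [← ENNReal.toReal_add (P.apply_ne_top _) (P.apply_ne_top _)]
  refine ENNReal.toReal_le_of_le_ofReal zero_le_one ?_
  have h := ENNReal.sum_le_tsum (f := P) {.accept, .reject}
  rw [sum_pair (by simp), P.tsum_coe] at h
  simpa using h

namespace IsUniformityTester

variable {N : ℕ} [NeZero N] {T : RandAlg N} {ε : ℝ} {q : ℕ}

lemma le_tsum_acc_one (hT : IsUniformityTester T ε q) :
    ENNReal.ofReal (2 / 3) ≤ ∑' t, T t * ENNReal.ofReal (t.acc fun _ => 1) := by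
  have hN : (0 : ℝ) < N := by exact_mod_cast NeZero.pos N
  rw [← T.run_accept (D := PMF.uniformOfFintype (Fin N)) (c := 1 / N) (by positivity)
    (fun _ => one_pos)]
  · exact ENNReal.ofReal_le_of_le_toReal (hT.accepts _ rfl)
  · intro i
    rw [PMF.uniformOfFintype_apply, mul_one, one_div, ENNReal.ofReal_inv_of_pos hN]
    simp

lemma tsum_acc_le (hT : IsUniformityTester T ε q) {f : Fin N → ℝ} (hf : ∀ i, 0 < f i)
    (hsum : ∑ i, f i = N) (hfar : 2 * ε * N ≤ ∑ i, |f i - 1|) :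
    ∑' t, T t * ENNReal.ofReal (t.acc f) ≤ ENNReal.ofReal (1 / 3) := by
  have hN : (0 : ℝ) < N := by exact_mod_cast NeZero.pos N
  have hf' : ∀ i, 0 ≤ 1 / (N : ℝ) * f i := fun i => mul_nonneg (by positivity) (hf i).le
  let D : PMF (Fin N) := PMF.ofFintype (fun i => ENNReal.ofReal (1 / N * f i)) (by
    rw [← ENNReal.ofReal_sum_of_nonneg fun i _ => hf' i, ← mul_sum, hsum]
    simp [hN.ne'])
  have hD : ∀ i, D i = ENNReal.ofReal (1 / N * f i) := fun i => rfl
  have htv : ε ≤ tvDist D (PMF.uniformOfFintype (Fin N)) := by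
    have : ∀ i, |(D i).toReal - (PMF.uniformOfFintype (Fin N) i).toReal| = |f i - 1| / N := by
      intro i
      rw [hD, ENNReal.toReal_ofReal (hf' i), PMF.uniformOfFintype_apply, ENNReal.toReal_inv,
        Fintype.card_fin, ENNReal.toReal_natCast, ← abs_of_pos hN, ← abs_div, abs_of_pos hN]
      congr 1
      field_simp
    simp only [tvDist, this]
    rw [← sum_div, mul_div_assoc', le_div_iff₀ hN]
    linarith
  rw [← T.run_accept (by positivity : 0 < 1 / (N : ℝ)) hf hD]
  refine ENNReal.le_ofReal_iff_toReal_le (PMF.apply_ne_top _ _) (by norm_num) |>.2 ?_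
  linarith [hT.rejects D htv, accept_add_reject_le_one (T.run D)]

/-- If the acceptance probability under the uniform distribution is nearly an average of
those under far distributions, for each algorithm making few queries, then there is no tester. -/
lemma one_third_le (hT : IsUniformityTester T ε q) {ι : Type*} (S : Finset ι) (μ : ι → ℝ)
    (hμ : ∀ j, 0 ≤ μ j) (hμ1 : ∑ j ∈ S, μ j = 1) (f : ι → Fin N → ℝ)
    (hf : ∀ j ∈ S, ∀ i, 0 < f j i) (hsum : ∀ j ∈ S, ∑ i, f j i = N)
    (hfar : ∀ j ∈ S, 2 * ε * N ≤ ∑ i, |f j i - 1|) {e : ℝ} (he : 0 ≤ e)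
    (h : ∀ t : DetAlg N, t.queries ≤ q → t.acc (fun _ => 1) ≤ ∑ j ∈ S, μ j * t.acc (f j) + e) :
    1 / 3 ≤ e := by
  have hacc : ∀ t : DetAlg N, ∀ j ∈ S, 0 ≤ t.acc (f j) := fun t j hj =>
    DetAlg.acc_nonneg (fun i => (hf j hj i).le) t
  have key : ENNReal.ofReal (2 / 3) ≤ ENNReal.ofReal (1 / 3 + e) := by
    calc _ ≤ ∑' t, T t * ENNReal.ofReal (t.acc fun _ => 1) := hT.le_tsum_acc_one
      _ ≤ ∑' t, (∑ j ∈ S, ENNReal.ofReal (μ j) * (T t * ENNReal.ofReal (t.acc (f j))) +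
            T t * ENNReal.ofReal e) := by
          refine ENNReal.tsum_le_tsum fun t => ?_
          by_cases ht : t ∈ T.support
          · calc _ ≤ T t * ENNReal.ofReal (∑ j ∈ S, μ j * t.acc (f j) + e) := by
                  gcongr
                  exact h t (hT.queries_le t ht)
              _ = _ := by
                  have hj : ∀ j ∈ S, 0 ≤ μ j * t.acc (f j) := fun j hj =>
                    mul_nonneg (hμ j) (hacc t j hj)
                  rw [ENNReal.ofReal_add (sum_nonneg hj) he, ENNReal.ofReal_sum_of_nonneg hj,
                    mul_add, mul_sum]
                  congr 1
                  refine sum_congr rfl fun j _ => ?_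
                  rw [ENNReal.ofReal_mul (hμ j)]
                  ring
          · rw [(PMF.apply_eq_zero_iff T t).2 ht]
            simp
      _ = ∑ j ∈ S, ENNReal.ofReal (μ j) * ∑' t, T t * ENNReal.ofReal (t.acc (f j)) +
            ENNReal.ofReal e := by
          rw [ENNReal.tsum_add, Summable.tsum_finsetSum fun _ _ => ENNReal.summable,
            ENNReal.tsum_mul_right, T.tsum_coe, one_mul]
          simp only [ENNReal.tsum_mul_left]
      _ ≤ ∑ j ∈ S, ENNReal.ofReal (μ j) * ENNReal.ofReal (1 / 3) + ENNReal.ofReal e := by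
          gcongr with j hj
          exact hT.tsum_acc_le (hf j hj) (hsum j hj) (hfar j hj)
      _ = _ := by
          rw [← sum_mul, ← ENNReal.ofReal_sum_of_nonneg fun j _ => hμ j, hμ1,
            ENNReal.ofReal_one, one_mul, ENNReal.ofReal_add (by norm_num) he]
  have := (ENNReal.ofReal_le_ofReal_iff (by positivity)).1 key
  linarith

end IsUniformityTester

/-! ### The perturbed densities -/

/-- The `p`-th pair of adjacent blocks of length `L` is admissible if it is not the first one and
lies below `M`. -/
def AdmissiblePair (M L p : ℕ) : Prop := 1 ≤ p ∧ 2 * L * (p + 1) ≤ M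

open scoped Classical in
/-- The fluctuation at the position `u`: it is `s p` on the first block and `-s p` on the second
block of the `p`-th pair, if this pair is admissible. -/
def fluct (M L : ℕ) (s : ℕ → ℝ) (u : ℕ) : ℝ :=
  if AdmissiblePair M L (u / L / 2) then
    s (u / L / 2) * if u / L % 2 = 0 then 1 else -1
  else 0

open scoped Classical in
/-- The partial sums of `fluct`. -/
def tent (M L : ℕ) (s : ℕ → ℝ) (u : ℕ) : ℝ :=
  if AdmissiblePair M L (u / (2 * L)) then
    s (u / (2 * L)) * min ((u % (2 * L) : ℕ) : ℝ) (2 * L - (u % (2 * L) : ℕ))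
  else 0

lemma tent_succ_sub {M L : ℕ} (hL : 0 < L) (s : ℕ → ℝ) (u : ℕ) :
    tent M L s (u + 1) - tent M L s u = fluct M L s u := by
  obtain ⟨p, r, hr, rfl⟩ : ∃ p r, r < 2 * L ∧ u = 2 * L * p + r :=
    ⟨u / (2 * L), u % (2 * L), Nat.mod_lt _ (by omega), (Nat.div_add_mod u (2 * L)).symm⟩
  have e1 : (2 * L * p + r) / (2 * L) = p := by
    rw [Nat.mul_add_div (by omega), Nat.div_eq_of_lt hr, add_zero]
  have e2 : (2 * L * p + r) % (2 * L) = r := by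
    rw [Nat.mul_add_mod, Nat.mod_eq_of_lt hr]
  have e3 : (2 * L * p + r) / L / 2 = p := by
    rw [Nat.div_div_eq_div_mul, mul_comm L 2, e1]
  have e4 : (2 * L * p + r) / L % 2 = 0 ↔ r < L := by
    rw [show 2 * L * p + r = L * (2 * p) + r by ring, Nat.mul_add_div hL, Nat.mul_add_mod]
    constructor
    · intro h
      by_contra hlt
      have h1 : 1 ≤ r / L := (Nat.one_le_div_iff hL).2 (by omega)
      have h2 : r / L < 2 := Nat.div_lt_of_lt_mul (by omega)
      omega
    · intro h
      rw [Nat.div_eq_of_lt h]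
  unfold tent fluct
  rw [e1, e2, e3]
  simp only [e4]
  rcases Nat.lt_or_ge (r + 1) (2 * L) with h | h
  · have e5 : (2 * L * p + r + 1) / (2 * L) = p := by
      rw [add_assoc, Nat.mul_add_div (by omega), Nat.div_eq_of_lt h, add_zero]
    have e6 : (2 * L * p + r + 1) % (2 * L) = r + 1 := by
      rw [add_assoc, Nat.mul_add_mod, Nat.mod_eq_of_lt h]
    rw [e5, e6]
    by_cases ha : AdmissiblePair M L p
    · simp only [ha, if_true]
      rw [← mul_sub]
      congr 1
      push_cast
      split_ifs with h1
      · have : (r : ℝ) + 1 ≤ L := by exact_mod_cast h1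
        rw [min_eq_left (by linarith), min_eq_left (by linarith)]
        ring
      · have : (L : ℝ) ≤ r := by exact_mod_cast not_lt.1 h1
        rw [min_eq_right (by linarith), min_eq_right (by linarith)]
        ring
    · simp only [ha, if_false, sub_zero]
  -- At the end of a pair the next remainder is `0`, where `tent` vanishes whether or not the next
  -- pair is admissible.
  · have hr1 : r + 1 = 2 * L := by omega
    have e5 : (2 * L * p + r + 1) % (2 * L) = 0 := by
      rw [add_assoc, hr1, Nat.mul_add_mod, Nat.mod_self]
    have hr2 : (r : ℝ) + 1 = 2 * L := by exact_mod_cast hr1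
    have hL1 : (1 : ℝ) ≤ L := by exact_mod_cast hL
    rw [e5, if_neg (show ¬ r < L by omega)]
    push_cast
    rw [min_eq_left (by linarith), min_eq_right (by linarith)]
    simp only [mul_zero, ite_self, zero_sub]
    split_ifs
    · linear_combination s p * hr2
    · ring

/-- Telescoping: only the pairs at the two ends of an interval contribute, whatever its length. -/
lemma sum_Icc_fluct {M L : ℕ} (hL : 0 < L) (s : ℕ → ℝ) {a b : ℕ} (hab : a ≤ b) (t : ℕ) :
    ∑ i ∈ Icc a b, fluct M L s (i + t) = tent M L s (b + 1 + t) - tent M L s (a + t) := by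
  have h := Finset.sum_Ico_sub (fun i => tent M L s (i + t)) (show a ≤ b + 1 by omega)
  rw [← h]
  refine sum_congr (by ext; simp) fun i _ => ?_
  rw [← tent_succ_sub hL, show i + 1 + t = i + t + 1 by omega]

lemma abs_fluct_le_one {M L : ℕ} {s : ℕ → ℝ} (hs : ∀ p, |s p| ≤ 1) (u : ℕ) :
    |fluct M L s u| ≤ 1 := by
  unfold fluct
  split_ifs <;> simp [hs]

lemma abs_tent_le {M L : ℕ} (hL : 0 < L) {s : ℕ → ℝ} (hs : ∀ p, |s p| ≤ 1) (u : ℕ) :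
    |tent M L s u| ≤ L := by
  unfold tent
  split_ifs
  · have h1 : ((u % (2 * L) : ℕ) : ℝ) ≤ 2 * L := by
      exact_mod_cast (Nat.mod_lt u (show 0 < 2 * L by omega)).le
    rw [abs_mul, abs_of_nonneg (a := min _ _) (le_min (Nat.cast_nonneg _) (by linarith))]
    refine (mul_le_of_le_one_left (le_min (Nat.cast_nonneg _) (by linarith)) (hs _)).trans ?_
    rcases le_total ((u % (2 * L) : ℕ) : ℝ) L with h | h
    · exact (min_le_left _ _).trans h
    · exact (min_le_right _ _).trans (by linarith)
  · simp

/-- The signs given by the bits `x`. -/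
def signs {M : ℕ} (x : Fin M → Bool) (p : ℕ) : ℝ :=
  if h : p < M then if x ⟨p, h⟩ then 1 else -1 else 0

lemma abs_signs_le_one {M : ℕ} (x : Fin M → Bool) (p : ℕ) : |signs x p| ≤ 1 := by
  unfold signs
  split_ifs <;> simp

lemma abs_signs_eq_one {M : ℕ} (x : Fin M → Bool) {p : ℕ} (hp : p < M) : |signs x p| = 1 := by
  unfold signs
  split_ifs <;> simp

lemma signs_flip {M : ℕ} (x : Fin M → Bool) (j : Fin M) (p : ℕ) :
    signs (flip j x) p = if p = j then -signs x p else signs x p := by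
  unfold signs flip
  by_cases hp : p < M
  · by_cases hj : p = j
    · subst hj
      cases h : x j <;> simp [h]
    · have : (⟨p, hp⟩ : Fin M) ≠ j := fun h => hj (congrArg Fin.val h)
      simp [hp, hj, Function.update_of_ne this]
  · simp [hp]

/-- The index of the pair of blocks of length `L`, shifted by `t`, containing `i`. -/
def pairIndex (N L t : ℕ) (i : Fin N) : Fin (N + t) :=
  ⟨(i + t) / L / 2, by
    have h1 := Nat.div_le_self (i + t) L
    have h2 := Nat.div_le_self ((i + t) / L) 2
    omega⟩

/-- The density which is perturbed with random signs on the pairs of blocks of length `L`,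
shifted by `t`. -/
def density (N L t : ℕ) (x : Fin (N + t) → Bool) (i : Fin N) : ℝ :=
  1 + 3 / 4 * fluct (N + t) L (signs x) (i + t)

lemma density_pos (N L t : ℕ) (x : Fin (N + t) → Bool) (i : Fin N) : 0 < density N L t x i := by
  have := (abs_le.1 (abs_fluct_le_one (M := N + t) (L := L) (abs_signs_le_one x) (i + t))).1
  unfold density
  linarith

lemma density_flip (N L t : ℕ) (j : Fin (N + t)) (x : Fin (N + t) → Bool) (i : Fin N) :
    density N L t (flip j x) i =
      if pairIndex N L t i = j then 2 - density N L t x i else density N L t x i := by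
  have : pairIndex N L t i = j ↔ (i + t) / L / 2 = j := by
    rw [Fin.ext_iff]
    rfl
  simp only [this, density, fluct, signs_flip]
  split_ifs <;> ring

lemma sum_Icc_coe {N : ℕ} {R : Type*} [AddCommMonoid R] (a b : Fin N) (g : ℕ → R) :
    ∑ s : Set.Icc a b, g s.1 = ∑ i ∈ Icc (a : ℕ) b, g i := by
  refine sum_nbij (fun s => s.1.1) (fun s _ => ?_) (fun s _ r _ h => ?_) (fun i hi => ?_)
    fun s _ => rfl
  · exact Finset.mem_Icc.2 s.2
  · exact Subtype.ext (Fin.ext h)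
  · have hi := Finset.mem_Icc.1 (Finset.mem_coe.1 hi)
    exact ⟨⟨⟨i, hi.2.trans_lt b.2⟩, Set.mem_Icc.2 ⟨hi.1, hi.2⟩⟩, by simp, rfl⟩

lemma card_Icc_coe {N : ℕ} (a b : Fin N) :
    Fintype.card (Set.Icc a b) = (b : ℕ) + 1 - a := by
  simp

/-! ### Long and flat queries -/

/-- The query `[a, b]` is at least `K` times as long as a block. -/
def LongQuery (N K L : ℕ) (a b : Fin N) : Prop := K * L ≤ (b : ℕ) + 1 - a

/-- The query `[a, b]` is contained in one block. -/
def FlatQuery (N L t : ℕ) (a b : Fin N) : Prop := (a + t) / L = (b + t) / L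

instance (N K L : ℕ) : DecidableRel (LongQuery N K L) := fun _ _ => Nat.decLe _ _

instance (N L t : ℕ) : DecidableRel (FlatQuery N L t) := fun _ _ => Nat.decEq _ _

lemma FlatQuery.density_eq {N L t : ℕ} {a b : Fin N} (h : FlatQuery N L t a b)
    (x : Fin (N + t) → Bool) (s : Set.Icc a b) : density N L t x s = density N L t x a := by
  have h1 : (s + t) / L = ((a : ℕ) + t) / L := by
    have ha : (a : ℕ) ≤ s := s.2.1
    have hb : (s : ℕ) ≤ b := s.2.2
    refine le_antisymm ?_ ?_
    · rw [h]
      exact Nat.div_le_div_right (by omega)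
    · exact Nat.div_le_div_right (by omega)
  unfold density fluct
  rw [h1]

/-- The two end pairs add at most `2 * L`, a fraction `2 / K` of the length, and `(1 - 2 / K) * (1 +
2 / K) ≤ 1`. -/
lemma LongQuery.mul_sum_density_le {N K L t : ℕ} (hL : 0 < L) (hK : 2 ≤ K) {a b : Fin N}
    (h : LongQuery N K L a b) (x : Fin (N + t) → Bool) :
    (1 - 2 / K : ℝ) * ∑ s : Set.Icc a b, density N L t x s ≤ Fintype.card (Set.Icc a b) := by
  have hK' : (2 : ℝ) ≤ K := by exact_mod_cast hK
  have hL' : (0 : ℝ) < L := by exact_mod_cast hL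
  have hab : (a : ℕ) ≤ b := by
    by_contra hab
    rw [LongQuery, show (b : ℕ) + 1 - a = 0 by omega] at h
    have : 0 < K * L := by positivity
    omega
  have hlen : (K * L : ℝ) ≤ Fintype.card (Set.Icc a b) := by
    rw [card_Icc_coe]
    exact_mod_cast h
  set c : ℝ := (Fintype.card (Set.Icc a b) : ℝ)
  have hsum : ∑ s : Set.Icc a b, density N L t x s ≤ c * (1 + 2 / K) := by
    simp only [density, sum_add_distrib, ← mul_sum]
    rw [sum_Icc_coe a b fun i => fluct (N + t) L (signs x) (i + t), sum_Icc_fluct hL _ hab]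
    have h1 := abs_le.1 (abs_tent_le (M := N + t) hL (abs_signs_le_one x) (b + 1 + t))
    have h2 := abs_le.1 (abs_tent_le (M := N + t) hL (abs_signs_le_one x) (a + t))
    have h3 : (L : ℝ) ≤ c / K := by
      rw [le_div_iff₀ (by linarith)]
      linarith
    have h4 : c * (1 + 2 / K) = c + 2 * (c / K) := by ring
    simp only [sum_const, card_univ, nsmul_eq_mul, mul_one]
    change c + _ ≤ _
    rw [h4]
    linarith
  have hK2 : (2 : ℝ) / K ≤ 1 := by rw [div_le_one (by linarith)]; exact hK'
  have hc0 : 0 ≤ c := Nat.cast_nonneg _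
  calc _ ≤ (1 - 2 / K : ℝ) * (c * (1 + 2 / K)) :=
        mul_le_mul_of_nonneg_left hsum (by linarith)
    _ = c - c * (2 / K) ^ 2 := by ring
    _ ≤ c := by
        have : 0 ≤ c * (2 / K : ℝ) ^ 2 := by positivity
        linarith

lemma LongQuery.card_pairIndex_le {N K L t : ℕ} (hL : 0 < L) (hK : 0 < K) {a b : Fin N}
    (h : LongQuery N K L a b) (j : Fin (N + t)) :
    (#{s : Set.Icc a b | pairIndex N L t s = j} : ℝ) ≤
      2 / K * Fintype.card (Set.Icc a b) := by
  have h1 : #{s : Set.Icc a b | pairIndex N L t s = j} ≤ #(Ico (2 * L * j) (2 * L * j + 2 * L)) := by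
    refine card_le_card_of_injOn (fun s => s.1.1 + t) (fun s hs => ?_) fun s _ r _ hsr => ?_
    · have hs : ((s : ℕ) + t) / L / 2 = j := congrArg Fin.val (mem_filter.1 hs).2
      rw [Nat.div_div_eq_div_mul, mul_comm L 2] at hs
      have e1 := Nat.div_add_mod ((s : ℕ) + t) (2 * L)
      have e2 := Nat.mod_lt ((s : ℕ) + t) (show 0 < 2 * L by omega)
      rw [hs] at e1
      simp only [coe_Ico, Set.mem_Ico]
      omega
    · exact Subtype.ext (Fin.ext (by simpa using hsr))
  rw [Nat.card_Ico, Nat.add_sub_cancel_left] at h1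
  have hK' : (0 : ℝ) < K := by exact_mod_cast hK
  have hlen : (K * L : ℝ) ≤ Fintype.card (Set.Icc a b) := by
    rw [card_Icc_coe]
    exact_mod_cast h
  calc (#{s : Set.Icc a b | pairIndex N L t s = j} : ℝ) ≤ 2 * L := by exact_mod_cast h1
    _ = 2 / K * (K * L) := by field_simp
    _ ≤ _ := by gcongr

/-! ### Total mass and distance from uniform -/

/-- Admissibility discards the pairs that the ends of the domain may cut, so `tent` vanishes at both
`t` and `N + t`. -/
lemma sum_density {N L t : ℕ} (hN : 0 < N) (ht : t < L) (x : Fin (N + t) → Bool) :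
    ∑ i, density N L t x i = N := by
  have hL : 0 < L := by omega
  have h0 : ∑ i : Fin N, fluct (N + t) L (signs x) (i + t) = 0 := by
    rw [Fin.sum_univ_eq_sum_range fun i => fluct (N + t) L (signs x) (i + t),
      show range N = Icc 0 (N - 1) by ext; simp; omega, sum_Icc_fluct hL _ (Nat.zero_le _),
      show N - 1 + 1 + t = N + t by omega, zero_add, tent, tent, if_neg, if_neg, sub_zero]
    · rintro ⟨h, -⟩
      rw [Nat.div_eq_of_lt (by omega)] at h
      omega
    · rintro ⟨-, h⟩
      exact absurd h (not_le.2 (Nat.lt_mul_div_succ _ (by omega)))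
  simp [density, sum_add_distrib, ← mul_sum, h0]

/-- Outside margins of `2 * L` at each end the deviation is exactly `3/4`; the inequality `2/3 * N ≤
3/4 * (N - 4 * L)` is equivalent to `36 * L ≤ N`. -/
lemma le_sum_abs_density_sub_one {N L t : ℕ} (hL : 0 < L) (hN : 36 * L ≤ N)
    (x : Fin (N + t) → Bool) : 2 * (1 / 3 : ℝ) * N ≤ ∑ i, |density N L t x i - 1| := by
  have h1 : ∀ i ∈ Ico (2 * L) (N - 2 * L), |fluct (N + t) L (signs x) (i + t)| = 1 := by
    intro i hi
    rw [mem_Ico] at hi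
    have e1 := Nat.div_le_self (i + t) L
    have e2 := Nat.div_le_self ((i + t) / L) 2
    have hp : AdmissiblePair (N + t) L ((i + t) / L / 2) := by
      rw [Nat.div_div_eq_div_mul, mul_comm L 2]
      refine ⟨(Nat.one_le_div_iff (by omega)).2 (by omega), ?_⟩
      have := Nat.mul_div_le (i + t) (2 * L)
      rw [mul_add]
      omega
    rw [fluct, if_pos hp, abs_mul, abs_signs_eq_one x (by omega)]
    split_ifs <;> simp
  have h2 : (N - 4 * L : ℝ) ≤ ∑ i : Fin N, |fluct (N + t) L (signs x) (i + t)| := by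
    rw [Fin.sum_univ_eq_sum_range fun i => |fluct (N + t) L (signs x) (i + t)|]
    calc (N - 4 * L : ℝ) = ∑ i ∈ Ico (2 * L) (N - 2 * L), (1 : ℝ) := by
          rw [sum_const, Nat.card_Ico, nsmul_eq_mul, mul_one,
            show N - 2 * L - 2 * L = N - 4 * L by omega, Nat.cast_sub (by omega)]
          push_cast
          rfl
      _ = ∑ i ∈ Ico (2 * L) (N - 2 * L), |fluct (N + t) L (signs x) (i + t)| :=
          sum_congr rfl fun i hi => (h1 i hi).symm
      _ ≤ _ := sum_le_sum_of_subset_of_nonneg (fun i hi => by simp at hi ⊢; omega)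
          fun _ _ _ => abs_nonneg _
  have h3 : (36 * L : ℝ) ≤ N := by exact_mod_cast hN
  have h4 : ∀ i, |density N L t x i - 1| = 3 / 4 * |fluct (N + t) L (signs x) (i + t)| := by
    intro i
    rw [density, add_sub_cancel_left, abs_mul, abs_of_pos (by norm_num : (0 : ℝ) < 3 / 4)]
  simp only [h4, ← mul_sum]
  linarith

/-! ### Random shift and random scale -/

/-- Few shifts `t` separate two given nearby points. -/
lemma card_filter_div_ne_le {L a b : ℕ} (hab : a ≤ b) :
    #{t ∈ range L | (a + t) / L ≠ (b + t) / L} ≤ b - a := by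
  rw [← Nat.card_Ioc]
  -- A separating shift puts a multiple of `L` in `(a + t, b + t]`; shifting it back by `t` gives a
  -- point of `(a, b]` whose residue modulo `L` determines `t < L`.
  refine card_le_card_of_injOn (fun t => L * ((b + t) / L) - t) (fun t ht => ?_)
    fun t ht r hr h => ?_
  · obtain ⟨htL, hne⟩ := mem_filter.1 ht
    rw [mem_range] at htL
    have h1 := Nat.mul_div_le (b + t) L
    have h2 : (a + t) / L < (b + t) / L :=
      lt_of_le_of_ne (Nat.div_le_div_right (by omega)) hne
    have h3 := Nat.lt_mul_div_succ (a + t) (show 0 < L by omega)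
    have h4 : L * ((a + t) / L + 1) ≤ L * ((b + t) / L) := Nat.mul_le_mul_left _ h2
    simp only [coe_Ioc, Set.mem_Ioc]
    omega
  -- The second bound ensures that the natural subtraction does not truncate.
  · have aux : ∀ t ∈ {t ∈ range L | (a + t) / L ≠ (b + t) / L}, t < L ∧ t ≤ L * ((b + t) / L) := by
      intro t ht
      obtain ⟨htL, hne⟩ := mem_filter.1 ht
      rw [mem_range] at htL
      have h2 : (a + t) / L < (b + t) / L :=
        lt_of_le_of_ne (Nat.div_le_div_right (by omega)) hne
      exact ⟨htL, htL.le.trans (Nat.le_mul_of_pos_right _ (Nat.zero_lt_of_lt h2))⟩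
    obtain ⟨ht1, ht2⟩ := aux t ht
    obtain ⟨hr1, hr2⟩ := aux r hr
    simp only at h
    have h1 : L * ((b + t) / L) + r = L * ((b + r) / L) + t := by omega
    have h2 := congrArg (· % L) h1
    simpa [Nat.mul_add_mod, Nat.mod_eq_of_lt ht1, Nat.mod_eq_of_lt hr1] using h2.symm

/-- A fixed query is neither long nor flat with small probability, over a random shift of the
blocks of length `K ^ (2 * k)`, except when its length is within a factor `K` of the length of the
blocks. -/
lemma sum_range_bad_le {N K : ℕ} (hK : 0 < K) (k : ℕ) {a b : Fin N} (hab : a ≤ b) :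
    ∑ t ∈ range (K ^ (2 * k)),
        (if LongQuery N K (K ^ (2 * k)) a b ∨ FlatQuery N (K ^ (2 * k)) t a b then 0 else 1 : ℝ) ≤
      (K ^ (2 * k) : ℕ) * (1 / K + if ((b : ℕ) + 1 - a) < K ^ (2 * k + 1) ∧
        K ^ (2 * k + 1) < K ^ 2 * ((b : ℕ) + 1 - a) then 1 else 0) := by
  have hK' : (0 : ℝ) < K := by exact_mod_cast hK
  have hab' : (a : ℕ) ≤ b := hab
  set L := K ^ (2 * k)
  have hKL : K ^ (2 * k + 1) = K * L := by rw [pow_succ, mul_comm]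
  rw [hKL]
  by_cases h1 : K * L ≤ (b : ℕ) + 1 - a
  · have : LongQuery N K L a b := h1
    simp only [this, true_or, if_true, sum_const_zero]
    positivity
  by_cases h2 : K * L < K ^ 2 * ((b : ℕ) + 1 - a)
  · rw [if_pos ⟨not_le.1 h1, h2⟩]
    calc _ ≤ ∑ t ∈ range L, (1 : ℝ) := sum_le_sum fun t _ => by split_ifs <;> norm_num
      _ = L * (0 + 1) := by simp
      _ ≤ _ := by gcongr; positivity
  · rw [if_neg fun h => h2 h.2, add_zero]
    have h3 : K * ((b : ℕ) - a) ≤ L := by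
      have h4 : K * (K * ((b : ℕ) + 1 - a)) ≤ K * L := by
        rw [← mul_assoc, ← pow_two]
        exact not_lt.1 h2
      exact (Nat.mul_le_mul_left K (by omega)).trans (Nat.le_of_mul_le_mul_left h4 hK)
    have h5 : ((b - a : ℕ) : ℝ) ≤ L * (1 / K) := by
      rw [mul_one_div, le_div_iff₀ hK', mul_comm]
      exact_mod_cast h3
    refine le_trans ?_ h5
    calc _ ≤ ∑ t ∈ range L, (if (a + t) / L ≠ ((b : ℕ) + t) / L then 1 else 0 : ℝ) := by
          refine sum_le_sum fun t _ => ?_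
          by_cases h : (a + t) / L = ((b : ℕ) + t) / L
          · have : FlatQuery N L t a b := h
            simp [this, h]
          · rw [if_pos h]
            split_ifs <;> norm_num
      _ = (#{t ∈ range L | ((a : ℕ) + t) / L ≠ (b + t) / L} : ℝ) := by rw [sum_boole]
      _ ≤ _ := by exact_mod_cast card_filter_div_ne_le hab'

/-- Consecutive odd powers of `K` differ by the factor `K ^ 2`, so the open interval `(l, K ^ 2 *
l)` contains at most one. This is why block lengths are even powers. -/
lemma sum_scale_indicator_le_one {K : ℕ} (hK : 1 < K) (m l : ℕ) :
    ∑ k ∈ range m, (if l < K ^ (2 * k + 1) ∧ K ^ (2 * k + 1) < K ^ 2 * l then 1 else 0 : ℝ) ≤ 1 := by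
  rw [← sum_filter, sum_const, nsmul_eq_mul, mul_one]
  have aux : ∀ i j, K ^ (2 * i + 1) < K ^ 2 * l → l < K ^ (2 * j + 1) → i ≤ j := by
    intro i j hi hj
    have : K ^ (2 * i + 1) < K ^ (2 + (2 * j + 1)) := by
      rw [pow_add _ 2]
      exact hi.trans_le (Nat.mul_le_mul_left _ hj.le)
    have := (Nat.pow_lt_pow_iff_right hK).1 this
    omega
  have : #{k ∈ range m | l < K ^ (2 * k + 1) ∧ K ^ (2 * k + 1) < K ^ 2 * l} ≤ 1 := by
    refine card_le_one.2 fun i hi j hj => ?_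
    have hi := (mem_filter.1 hi).2
    have hj := (mem_filter.1 hj).2
    exact le_antisymm (aux i j hi.2 hj.1) (aux j i hj.2 hi.1)
  exact_mod_cast this

/-- The pairs of a scale `k < m` and a shift `t < K ^ (2 * k)`. -/
def scales (K m : ℕ) : Finset (Σ _ : ℕ, ℕ) := (range m).sigma fun k => range (K ^ (2 * k))

/-- The probability of a scale and a shift which are chosen uniformly, one after the other. -/
def scaleWeight (K m : ℕ) (θ : Σ _ : ℕ, ℕ) : ℝ := 1 / (m * (K ^ (2 * θ.1) : ℕ))

lemma scaleWeight_nonneg (K m : ℕ) (θ : Σ _ : ℕ, ℕ) : 0 ≤ scaleWeight K m θ := by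
  unfold scaleWeight
  positivity

lemma sum_scaleWeight {K m : ℕ} (hK : 0 < K) (hm : 0 < m) :
    ∑ θ ∈ scales K m, scaleWeight K m θ = 1 := by
  have hm' : (m : ℝ) ≠ 0 := by positivity
  rw [scales, sum_sigma]
  calc _ = ∑ k ∈ range m, (1 : ℝ) / m := by
        refine sum_congr rfl fun k _ => ?_
        have : ((K ^ (2 * k) : ℕ) : ℝ) ≠ 0 := by positivity
        simp only [scaleWeight, sum_const, card_range, nsmul_eq_mul]
        field_simp
    _ = 1 := by simp [hm']

lemma sum_scaleWeight_bad_le {N K m : ℕ} (hK : 1 < K) (hm : 0 < m) {a b : Fin N} (hab : a ≤ b) :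
    ∑ θ ∈ scales K m, scaleWeight K m θ *
        (if LongQuery N K (K ^ (2 * θ.1)) a b ∨ FlatQuery N (K ^ (2 * θ.1)) θ.2 a b
          then 0 else 1) ≤ 1 / m + 1 / K := by
  have hm' : (0 : ℝ) < m := by exact_mod_cast hm
  have hK' : (0 : ℝ) < K := by exact_mod_cast hK.trans' Nat.zero_lt_one
  rw [scales, sum_sigma]
  simp only [scaleWeight, ← mul_sum]
  calc _ ≤ ∑ k ∈ range m, 1 / (m : ℝ) * (1 / K +
          if ((b : ℕ) + 1 - a) < K ^ (2 * k + 1) ∧ K ^ (2 * k + 1) < K ^ 2 * ((b : ℕ) + 1 - a)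
            then 1 else 0) := by
        refine sum_le_sum fun k _ => ?_
        have hp : (0 : ℝ) < (K ^ (2 * k) : ℕ) := by positivity
        refine (mul_le_mul_of_nonneg_left (sum_range_bad_le hK.le k hab) (by positivity)).trans
          (le_of_eq ?_)
        field_simp
    _ = 1 / K + 1 / m * ∑ k ∈ range m,
          (if ((b : ℕ) + 1 - a) < K ^ (2 * k + 1) ∧ K ^ (2 * k + 1) < K ^ 2 * ((b : ℕ) + 1 - a)
            then 1 else 0 : ℝ) := by
        rw [← mul_sum, sum_add_distrib, mul_add, sum_const, card_range, nsmul_eq_mul,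
          ← mul_assoc, one_div_mul_cancel hm'.ne', one_mul]
    _ ≤ 1 / K + 1 / m * 1 := by
        gcongr
        exact sum_scale_indicator_le_one hK m _
    _ = _ := by ring

/-! ### Assembling the lower bound -/

/-- An algorithm with few queries hardly distinguishes the uniform distribution from the
perturbation with random scale, shift and signs. -/
lemma DetAlg.acc_one_le {N K m q : ℕ} (hK : 2 ≤ K) (hm : 0 < m) (t : DetAlg N)
    (ht : t.queries ≤ q) :
    t.acc (fun _ => 1) ≤
      ∑ θ ∈ scales K m, scaleWeight K m θ * (∑ x, t.acc (density N (K ^ (2 * θ.1)) θ.2 x) /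
        Fintype.card (Fin (N + θ.2) → Bool)) + q * (1 / m + 1 / K + (q + 1) * (2 / K)) := by
  have hK0 : 0 < K := by omega
  have hL : ∀ k, 0 < K ^ (2 * k) := fun k => by positivity
  have hK' : (2 : ℝ) ≤ K := by exact_mod_cast hK
  have hρ : 0 ≤ 1 - (2 : ℝ) / K := by
    rw [sub_nonneg, div_le_one (by linarith)]
    exact hK'
  have hloss := t.sum_acc_sub_goodAcc_le (scales K m) (scaleWeight K m) (scaleWeight_nonneg K m)
    (sum_scaleWeight hK0 hm) (J := fun θ => Fin (N + θ.2))
    (fun θ => pairIndex N (K ^ (2 * θ.1)) θ.2) (fun θ => LongQuery N K (K ^ (2 * θ.1)))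
    (fun θ => FlatQuery N (K ^ (2 * θ.1)) θ.2) (β := 1 / m + 1 / K) (γ := 2 / K) (by positivity)
    (fun θ _ a b hab j => hab.card_pairIndex_le (hL _) hK0 j)
    (fun a b hab => sum_scaleWeight_bad_le hK hm hab) q ht 0 (fun _ => ∅) (fun _ => by simp)
    (by positivity)
  set G : (Σ _ : ℕ, ℕ) → ℝ := fun θ => t.goodAcc (pairIndex N (K ^ (2 * θ.1)) θ.2)
    (LongQuery N K (K ^ (2 * θ.1))) (FlatQuery N (K ^ (2 * θ.1)) θ.2) ∅
  have hgood : ∀ θ, (1 - q * (2 / K) : ℝ) * G θ ≤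
      ∑ x, t.acc (density N (K ^ (2 * θ.1)) θ.2 x) / Fintype.card (Fin (N + θ.2) → Bool) := by
    intro θ
    have h := t.goodAcc_mul_sum_le (pairIndex N (K ^ (2 * θ.1)) θ.2)
      (LongQuery N K (K ^ (2 * θ.1))) (FlatQuery N (K ^ (2 * θ.1)) θ.2)
      (density N (K ^ (2 * θ.1)) θ.2) (density_pos N _ _) (density_flip N _ _) hρ
      (sub_le_self _ (by positivity)) (fun a b hab x => hab.mul_sum_density_le (hL _) hK x)
      (fun a b hab x s => hab.density_eq x s) q ht ∅ (fun _ => 1) (fun _ => zero_le_one)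
      (fun _ _ _ => rfl)
    simp only [one_mul, sum_const, card_univ, nsmul_eq_mul, mul_one] at h
    rw [← sum_div, le_div_iff₀ (by exact_mod_cast Fintype.card_pos)]
    refine le_trans ?_ h
    -- Bernoulli's inequality makes the multiplicative loss `(1 - 2 / K) ^ q` an additive one of at
    -- most `q * (2 / K)`.
    have hB := one_add_mul_le_pow (a := -((2 : ℝ) / K)) (by linarith) q
    have hG : 0 ≤ G θ := goodAcc_nonneg ..
    gcongr
    calc (1 - q * (2 / K) : ℝ) = 1 + q * -(2 / K) := by ring
      _ ≤ _ := hB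
  have hG1 : ∀ θ, G θ ≤ 1 := fun θ => (goodAcc_le_acc ..).trans t.acc_one_le_one
  have hsum1 := sum_scaleWeight hK0 hm
  calc t.acc (fun _ => 1) = ∑ θ ∈ scales K m, scaleWeight K m θ * G θ +
        ∑ θ ∈ scales K m, scaleWeight K m θ * (t.acc (fun _ => 1) - G θ) := by
        rw [← sum_add_distrib]
        simp only [← mul_add, add_sub_cancel, ← sum_mul, hsum1, one_mul]
    _ ≤ ∑ θ ∈ scales K m, scaleWeight K m θ * ((∑ x, t.acc (density N (K ^ (2 * θ.1)) θ.2 x) /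
          Fintype.card (Fin (N + θ.2) → Bool)) + q * (2 / K)) +
        q * (1 / m + 1 / K + ((0 : ℕ) + q) * (2 / K)) := by
        refine add_le_add (sum_le_sum fun θ _ => mul_le_mul_of_nonneg_left ?_
          (scaleWeight_nonneg K m θ)) hloss
        have h1 := hgood θ
        have h2 : (q * (2 / K) : ℝ) * G θ ≤ q * (2 / K) :=
          mul_le_of_le_one_right (by positivity) (hG1 θ)
        linarith
    _ = _ := by
        simp only [mul_add, sum_add_distrib, ← sum_mul, hsum1]
        push_cast
        ring

lemma IsUniformityTester.lt_mul_pow {N : ℕ} [NeZero N] {T : RandAlg N} {q : ℕ}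
    (hT : IsUniformityTester T (1 / 3) q) :
    N < 36 * (36 * q ^ 2 + 2) ^ (12 * q) := by
  by_contra! hN
  -- With `m = 6 * q + 1` scales, `q / m < 1/6`, and this `K` keeps the remaining error `(3 * q + 2
  -- * q ^ 2) / K` at most `1/6`. The summand `2` gives `K ≥ 2` even for `q = 0`. The largest block
  -- length is `K ^ (12 * q)`.
  set K := 36 * q ^ 2 + 2 with hKdef
  have hK : 2 ≤ K := by omega
  have hK0 : 0 < K := by omega
  have hscale : ∀ θ ∈ scales K (6 * q + 1), 36 * K ^ (2 * θ.1) ≤ N ∧ θ.2 < K ^ (2 * θ.1) := by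
    intro θ hθ
    rw [scales, mem_sigma, mem_range, mem_range] at hθ
    refine ⟨le_trans ?_ hN, hθ.2⟩
    exact Nat.mul_le_mul_left _ (Nat.pow_le_pow_right hK0 (by omega))
  have h := hT.one_third_le
    ((scales K (6 * q + 1)).sigma fun θ => (univ : Finset (Fin (N + θ.2) → Bool)))
    (fun j => scaleWeight K (6 * q + 1) j.1 * (1 / Fintype.card (Fin (N + j.1.2) → Bool)))
    (fun j => mul_nonneg (scaleWeight_nonneg ..) (by positivity))
    (by
      refine Eq.trans ?_ (sum_scaleWeight hK0 (Nat.succ_pos (6 * q)))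
      rw [sum_sigma]
      refine sum_congr rfl fun θ _ => ?_
      have : (Fintype.card (Fin (N + θ.2) → Bool) : ℝ) ≠ 0 := by
        exact_mod_cast Fintype.card_ne_zero
      change ∑ _x : Fin (N + θ.2) → Bool, scaleWeight K (6 * q + 1) θ *
        (1 / (Fintype.card (Fin (N + θ.2) → Bool) : ℝ)) = _
      rw [sum_const, card_univ, nsmul_eq_mul]
      field_simp)
    (fun j => density N (K ^ (2 * j.1.1)) j.1.2 j.2)
    (fun j _ i => density_pos ..)
    (fun j hj => sum_density (NeZero.pos N) (hscale j.1 (mem_sigma.1 hj).1).2 _)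
    (fun j hj => le_sum_abs_density_sub_one (by positivity) (hscale j.1 (mem_sigma.1 hj).1).1 _)
    (e := q * (1 / (6 * q + 1 : ℕ) + 1 / K + (q + 1) * (2 / K))) (by positivity)
    (fun t ht => by
      refine (t.acc_one_le hK (Nat.succ_pos (6 * q)) ht).trans (le_of_eq ?_)
      rw [sum_sigma]
      congr 1
      refine sum_congr rfl fun θ _ => ?_
      rw [mul_sum]
      exact sum_congr rfl fun x _ => by ring)
  have hq : (0 : ℝ) ≤ q := Nat.cast_nonneg q
  have hKr : (K : ℝ) = 36 * q ^ 2 + 2 := by rw [hKdef]; push_cast; ring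
  have e1 : (q : ℝ) * (1 / (6 * q + 1 : ℕ)) < 1 / 6 := by
    push_cast
    rw [mul_one_div, div_lt_div_iff₀ (by positivity) (by norm_num)]
    linarith
  have e2 : (q : ℝ) * (1 / K + (q + 1) * (2 / K)) ≤ 1 / 6 := by
    have : (q : ℝ) * (1 / K + (q + 1) * (2 / K)) = (3 * q + 2 * q ^ 2) / K := by ring
    rw [this, hKr, div_le_div_iff₀ (by positivity) (by norm_num)]
    rcases Nat.eq_zero_or_pos q with h0 | h0
    · simp [h0]
    · have : (1 : ℝ) ≤ q := by exact_mod_cast h0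
      nlinarith
  have e3 : (q : ℝ) * (1 / (6 * q + 1 : ℕ) + 1 / K + (q + 1) * (2 / K)) =
    q * (1 / (6 * q + 1 : ℕ)) + q * (1 / K + (q + 1) * (2 / K)) := by ring
  linarith

end DistributionTesting

end

/-! ### Solving for `q` -/

lemma DistributionTesting.log_le_of_lt_mul_pow {N q : ℕ} (hN : 36 ≤ N)
    (h : N < 36 * (36 * q ^ 2 + 2) ^ (12 * q)) :
    1 / 100 * (Real.log N / Real.log (Real.log N)) ≤ q := by
  have hN' : (36 : ℝ) ≤ N := by exact_mod_cast hN
  have hq : 1 ≤ q := by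
    by_contra hq
    rw [show q = 0 by omega] at h
    simp at h
    omega
  have hq' : (1 : ℝ) ≤ q := by exact_mod_cast hq
  have hexp3 : Real.exp 3 ≤ 36 := by
    rw [show (3 : ℝ) = (3 : ℕ) * 1 by norm_num, Real.exp_nat_mul]
    have := Real.exp_one_lt_d9
    calc Real.exp 1 ^ 3 ≤ 3 ^ 3 := by gcongr; linarith
      _ ≤ 36 := by norm_num
  have hexp4 : (38 : ℝ) ≤ Real.exp 4 := by
    rw [show (4 : ℝ) = (4 : ℕ) * 1 by norm_num, Real.exp_nat_mul]
    have := Real.exp_one_gt_d9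
    calc (38 : ℝ) ≤ 2.7 ^ 4 := by norm_num
      _ ≤ Real.exp 1 ^ 4 := by gcongr; linarith
  have hlog3 : 3 ≤ Real.log N := by
    rw [Real.le_log_iff_exp_le (by linarith)]
    linarith
  have hlog38 : Real.log 38 ≤ 4 := by
    rw [Real.log_le_iff_le_exp (by norm_num)]
    exact hexp4
  have hll : 1 ≤ Real.log (Real.log N) := by
    rw [Real.le_log_iff_exp_le (by linarith)]
    linarith [Real.exp_one_lt_d9]
  set l := Real.log (Real.log N)
  rw [one_div_mul_eq_div, div_div, div_le_iff₀ (by positivity)]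
  -- If `log N ≤ q` the claim is immediate from `1 ≤ l`; otherwise `log q ≤ l`, which controls the
  -- `log q` in the exponent bound.
  rcases le_total (Real.log N) q with hlq | hlq
  · nlinarith
  have hlogq : Real.log q ≤ l := Real.log_le_log (by linarith) hlq
  have hbound : (N : ℝ) ≤ 38 * (38 * q ^ 2) ^ (12 * q) := by
    calc (N : ℝ) ≤ 36 * (36 * q ^ 2 + 2) ^ (12 * q) := by exact_mod_cast h.le
      _ ≤ _ := by
        gcongr
        · norm_num
        · nlinarith
  have hlog := Real.log_le_log (by linarith) hbound
  rw [Real.log_mul (by norm_num) (by positivity), Real.log_pow,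
    Real.log_mul (by norm_num) (by positivity), Real.log_pow] at hlog
  push_cast at hlog
  have h1 : 12 * (q : ℝ) * (Real.log 38 + 2 * Real.log q) ≤ 12 * q * (6 * l) := by
    gcongr
    linarith
  -- Here `log N ≤ 4 + 72 * q * l ≤ 76 * q * l`, within the constant `100`.
  nlinarith

theorem theorem8p3 :
    ∃ c : ℝ, 0 < c ∧ ∃ N₀ : ℕ, ∀ (N : ℕ) [NeZero N], N₀ ≤ N →
      ∀ (q : ℕ) (T : DistributionTesting.RandAlg N),
        DistributionTesting.IsUniformityTester T (1 / 3) q →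
          c * (Real.log N / Real.log (Real.log N)) ≤ q :=
  ⟨1 / 100, by norm_num, 36, fun _ _ hN _ _ hT =>
    DistributionTesting.log_le_of_lt_mul_pow hN hT.lt_mul_pow⟩
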